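/- Let $k$ be a commutative ring with unit and let $\mathcal{E}$ be a small semi-additive category (a category with finite products and finite coproducts such that for every finite family of objects the canonical morphism from the coproduct to the product is an isomorphism). Let $\mathbf{Mon}$ be the category of commutative monoids, written additively. For $\mathcal{C}=\mathcal{E}$ or $\mathcal{C}=\mathcal{E}^{op}$, let $Rep(\mathcal{C})$ be the category of additive functors $\mathcal{C}\to\mathbf{Mon}$, i.e. functors that commute with finite direct sums, with all natural transformations as morphisms. For $F\in Rep(\mathcal{C})$ let $k[F]$ be the functor $c\mapsto k[F(c)]$ from $\mathcal{C}$ to $k$-modules, where $k[X]$ is the free $k$-module on the set $X$. For functors $M$ from $\mathcal{E}^{op}$ and $N$ from $\mathcal{E}$ to $k$-modules let $$M\otimes_{\mathcal{E}}N:=\int^{c\in\mathcal{E}}M(c)\otimes_kN(c),$$ a coend in the category of $k$-modules. For $A\in Rep(\mathcal{E}^{op})$ and $B\in Rep(\mathcal{E})$ let $$A\otimes_{\mathcal{E}}B:=\int^{c\in\mathcal{E}}A(c)\otimes_{\mathbb{N}}B(c),$$ a coend in $\mathbf{Mon}$, where $P\otimes_{\mathbb{N}}Q$ is the tensor product of commutative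 monoids: the quotient of the free commutative monoid on $P\times Q$ by the congruence generated by $(p+p',q)\sim(p,q)+(p',q)$, $(p,q+q')\sim(p,q)+(p,q')$, $(0,q)\sim 0$ and $(p,0)\sim 0$. Proposition 3.4. For $A\in Rep(\mathcal{E}^{op})$ and $B\in Rep(\mathcal{E})$ there is an isomorphism of $k$-modules $$k[A]\otimes_{\mathcal{E}}k[B]\;\cong\;k[A\otimes_{\mathcal{E}}B],$$ natural in $A$ and $B$. -/

import Mathlib

open CategoryTheory CategoryTheory.Limits Opposite
open scoped TensorProduct

universe u v

/-! ### Colimits of commutative monoids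

Commutative monoids are written additively, so the category of commutative monoids is
`AddCommMonCat`. The colimit of a small diagram is the quotient of the direct sum of its values by
the congruence generated by the maps of the diagram. -/

namespace AddMonColimit

variable {J : Type u} [Category.{u} J] (F : J ⥤ AddCommMonCat.{u})

open Classical in
/-- The elementary relations: `x` in the summand `i` is identified with its image under `F f` in
the summand `j`, for all `f : i ⟶ j`. -/
inductive Rel : DirectSum J (fun j => F.obj j) → DirectSum J (fun j => F.obj j) → Prop
  | of {i j : J} (f : i ⟶ j) (x : F.obj i) :
      Rel (DirectSum.of (fun j => F.obj j) i x) (DirectSum.of (fun j => F.obj j) j (F.map f x))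

/-- The congruence generated by the elementary relations. -/
def con : AddCon (DirectSum J (fun j => F.obj j)) := addConGen (Rel F)

open Classical in
/-- The cocone on `F` whose point is the quotient of the direct sum. -/
noncomputable def cocone : Cocone F where
  pt := AddCommMonCat.of (con F).Quotient
  ι :=
    { app := fun j => AddCommMonCat.ofHom
        ((con F).mk'.comp (DirectSum.of (fun j => F.obj j) j))
      naturality := by
        intro i j f
        ext x
        exact ((con F).eq.mpr (AddConGen.Rel.of _ _ (Rel.of f x))).symm }

open Classical in
/-- The map from the direct sum to the point of a cocone. -/
noncomputable def descAux (s : Cocone F) : DirectSum J (fun j => F.obj j) →+ s.pt :=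
  DirectSum.toAddMonoid (fun j => AddCommMonCat.Hom.hom (Y := s.pt) (s.ι.app j))

open Classical in
theorem descAux_of (s : Cocone F) (j : J) (x : F.obj j) :
    descAux F s (DirectSum.of (fun j => F.obj j) j x) = s.ι.app j x :=
  DirectSum.toAddMonoid_of (β := fun j => F.obj j)
    (fun j => AddCommMonCat.Hom.hom (Y := s.pt) (s.ι.app j)) j x

open Classical in
/-- The quotient of the direct sum is a colimit. -/
noncomputable def isColimit : IsColimit (cocone F) where
  desc s := AddCommMonCat.ofHom <| (con F).lift
    (descAux F s) (by
      refine AddCon.addConGen_le.mpr ?_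
      rintro _ _ ⟨f, x⟩
      rw [AddCon.ker_rel, descAux_of, descAux_of]
      exact (ConcreteCategory.congr_hom (s.w f) x).symm)
  fac s j := by
    ext x
    exact descAux_of F s j x
  uniq s m hm := by
    apply AddCommMonCat.hom_ext
    apply AddCon.hom_ext
    apply DirectSum.addHom_ext
    intro j x
    refine (ConcreteCategory.congr_hom (hm j) x).trans ?_
    exact (descAux_of F s j x).symm

end AddMonColimit

instance AddCommMonCat.instHasColimits : HasColimits AddCommMonCat.{u} where
  has_colimits_of_shape _ _ :=
    { has_colimit := fun F => ⟨⟨⟨AddMonColimit.cocone F, AddMonColimit.isColimit F⟩⟩⟩ }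

/-! ### Tensor products of functors -/

theorem addMonTensor_hom_ext {M N P : AddCommMonCat.{u}}
    {f g : AddCommMonCat.of (M ⊗[ℕ] N) ⟶ P} (h : ∀ m n, f (m ⊗ₜ n) = g (m ⊗ₜ n)) : f = g := by
  apply AddCommMonCat.hom_ext
  ext x
  induction x using TensorProduct.induction_on with
  | zero => rw [map_zero, map_zero]
  | tmul m n => exact h m n
  | add x y hx hy => rw [map_add, map_add, hx, hy]

/-- The tensor product of commutative monoids as a bifunctor. A commutative monoid is the same
thing as an `ℕ`-module, and `M ⊗[ℕ] N` is the quotient of the free commutative monoid on `M × N`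
that makes the pairing `(m, n) ↦ m ⊗ₜ n` universal among the biadditive ones. -/
noncomputable def addMonTensor :
    AddCommMonCat.{u} ⥤ AddCommMonCat.{u} ⥤ AddCommMonCat.{u} where
  obj M :=
    { obj := fun N => AddCommMonCat.of (M ⊗[ℕ] N)
      map := fun g => AddCommMonCat.ofHom
        (TensorProduct.map LinearMap.id g.hom.toNatLinearMap).toAddMonoidHom
      map_id := by
        intro N
        apply addMonTensor_hom_ext
        intro m n
        rfl
      map_comp := by
        intro N N' N'' g g'
        apply addMonTensor_hom_ext
        intro m n
        rfl }
  map f :=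
    { app := fun N => AddCommMonCat.ofHom
        (TensorProduct.map f.hom.toNatLinearMap LinearMap.id).toAddMonoidHom
      naturality := by
        intro N N' g
        apply addMonTensor_hom_ext
        intro m n
        rfl }
  map_id := by
    intro M
    ext N : 2
    apply addMonTensor_hom_ext
    intro m n
    rfl
  map_comp := by
    intro M M' M'' f f'
    ext N : 2
    apply addMonTensor_hom_ext
    intro m n
    rfl

section Coend

variable {C : Type u} [Category.{u} C] {D : Type v} [Category.{u} D]

/-- For a bifunctor `T` on `D`, the bifunctor `(c, c') ↦ T (A c) (B c')` attached to
`A : Cᵒᵖ ⥤ D` and `B : C ⥤ D`. -/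
@[simps]
def externalTensorObj (T : D ⥤ D ⥤ D) (A : Cᵒᵖ ⥤ D) (B : C ⥤ D) : Cᵒᵖ ⥤ C ⥤ D where
  obj c :=
    { obj := fun c' => (T.obj (A.obj c)).obj (B.obj c')
      map := fun g => (T.obj (A.obj c)).map (B.map g) }
  map f := { app := fun c' => (T.map (A.map f)).app (B.obj c') }

/-- Functoriality of `externalTensorObj` in the second functor. -/
@[simps]
def externalTensorMapRight (T : D ⥤ D ⥤ D) (A : Cᵒᵖ ⥤ D) {B B' : C ⥤ D} (β : B ⟶ B') :
    externalTensorObj T A B ⟶ externalTensorObj T A B' where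
  app c :=
    { app := fun c' => (T.obj (A.obj c)).map (β.app c')
      naturality := fun x y g => ((T.obj (A.obj c)).map_comp (B.map g) (β.app y)).symm.trans
        ((congrArg (T.obj (A.obj c)).map (β.naturality g)).trans
          ((T.obj (A.obj c)).map_comp (β.app x) (B'.map g))) }
  naturality c c' f := by
    ext x
    exact ((T.map (A.map f)).naturality (β.app x)).symm

/-- Functoriality of `externalTensorObj` in the first functor. -/
@[simps]
def externalTensorMapLeft (T : D ⥤ D ⥤ D) {A A' : Cᵒᵖ ⥤ D} (α : A ⟶ A') (B : C ⥤ D) :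
    externalTensorObj T A B ⟶ externalTensorObj T A' B where
  app c :=
    { app := fun c' => (T.map (α.app c)).app (B.obj c')
      naturality := fun x y g => (T.map (α.app c)).naturality (B.map g) }
  naturality c c' f := by
    ext x
    have h : T.map (A.map f) ≫ T.map (α.app c') = T.map (α.app c) ≫ T.map (A'.map f) := by
      rw [← T.map_comp, ← T.map_comp, α.naturality]
    exact congrArg (fun t => t.app (B.obj x)) h

/-- The bifunctor `(c, c') ↦ T (A c) (B c')`, functorially in `A` and `B`. -/
@[simps]
def externalTensor (T : D ⥤ D ⥤ D) : (Cᵒᵖ ⥤ D) ⥤ (C ⥤ D) ⥤ (Cᵒᵖ ⥤ C ⥤ D) where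
  obj A :=
    { obj := fun B => externalTensorObj T A B
      map := fun β => externalTensorMapRight T A β
      map_id := fun B => by
        ext c x
        exact (T.obj (A.obj c)).map_id (B.obj x)
      map_comp := fun β β' => by
        ext c x
        exact (T.obj (A.obj c)).map_comp (β.app x) (β'.app x) }
  map α :=
    { app := fun B => externalTensorMapLeft T α B
      naturality := fun B B' β => by
        ext c x
        exact (T.map (α.app c)).naturality (β.app x) }
  map_id A := by
    ext B c x
    exact congrArg (fun t => t.app (B.obj x)) (T.map_id (A.obj c))
  map_comp α α' := by
    ext B c x
    exact congrArg (fun t => t.app (B.obj x)) (T.map_comp (α.app c) (α'.app c))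

variable [HasColimits D]

/-- The coend tensor product `A ⊗_C B = ∫^c T (A c) (B c)` of `A : Cᵒᵖ ⥤ D` and `B : C ⥤ D`,
functorially in `A` and `B`. -/
noncomputable def coendTensor (T : D ⥤ D ⥤ D) : (Cᵒᵖ ⥤ D) ⥤ (C ⥤ D) ⥤ D :=
  externalTensor T ⋙ (Functor.whiskeringRight _ _ _).obj (coendFunctor C D)

end Coend

/-- `A ⊗_C B` for functors to `k`-modules: the coend of `A(c) ⊗_k B(c)`. -/
noncomputable abbrev moduleCoendTensor (k : Type u) [CommRing k] (C : Type u) [Category.{u} C] :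
    (Cᵒᵖ ⥤ ModuleCat.{u} k) ⥤ (C ⥤ ModuleCat.{u} k) ⥤ ModuleCat.{u} k :=
  coendTensor (MonoidalCategory.curriedTensor (ModuleCat.{u} k))

/-- `A ⊗_C B` for functors to commutative monoids: the coend of `A(c) ⊗_ℕ B(c)`, computed in the
category of commutative monoids. -/
noncomputable abbrev addMonCoendTensor (C : Type u) [Category.{u} C] :
    (Cᵒᵖ ⥤ AddCommMonCat.{u}) ⥤ (C ⥤ AddCommMonCat.{u}) ⥤ AddCommMonCat.{u} :=
  coendTensor addMonTensor

/-! ### Additive functors and linearization -/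

/-- A functor to commutative monoids is additive if it commutes with finite direct sums. It is used
for `C` and for `Cᵒᵖ` with `C` semi-additive; both are then semi-additive and finite direct sums in
either of them, as in the target, are the finite products. -/
def isAdditiveFunctor (C : Type u) [Category.{u} C] : ObjectProperty (C ⥤ AddCommMonCat.{u}) :=
  fun F => PreservesFiniteProducts F

/-- The category of additive functors from `C` to commutative monoids; the morphisms are all the
natural transformations. -/
abbrev AddRep (C : Type u) [Category.{u} C] := (isAdditiveFunctor C).FullSubcategory

/-- The inclusion of the additive functors into all functors. -/
abbrev AddRep.incl (C : Type u) [Category.{u} C] : AddRep C ⥤ (C ⥤ AddCommMonCat.{u}) :=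
  (isAdditiveFunctor C).ι

/-- The free `k`-module `k[M]` on the underlying set of a commutative monoid `M`. -/
noncomputable abbrev freeOnAddMon (k : Type u) [CommRing k] :
    AddCommMonCat.{u} ⥤ ModuleCat.{u} k :=
  forget AddCommMonCat.{u} ⋙ ModuleCat.free k

/-- The linearization `A ↦ k[A]`, where `k[A](c) = k[A(c)]`. -/
noncomputable abbrev AddRep.linearization (k : Type u) [CommRing k] (C : Type u) [Category.{u} C] :
    AddRep C ⥤ (C ⥤ ModuleCat.{u} k) :=
  AddRep.incl C ⋙ (Functor.whiskeringRight _ _ _).obj (freeOnAddMon k)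

/-- The bifunctor `(A, B) ↦ k[A] ⊗_C k[B]`. -/
noncomputable def tensorOfLinearizations (k : Type u) [CommRing k]
    (C : Type u) [Category.{u} C] : AddRep Cᵒᵖ ⥤ AddRep C ⥤ ModuleCat.{u} k :=
  AddRep.linearization k Cᵒᵖ ⋙ moduleCoendTensor k C ⋙
    (Functor.whiskeringLeft _ _ _).obj (AddRep.linearization k C)

/-- The bifunctor `(A, B) ↦ k[A ⊗_C B]`. -/
noncomputable def linearizationOfTensor (k : Type u) [CommRing k]
    (C : Type u) [Category.{u} C] : AddRep Cᵒᵖ ⥤ AddRep C ⥤ ModuleCat.{u} k :=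
  AddRep.incl Cᵒᵖ ⋙ addMonCoendTensor C ⋙
    (Functor.whiskeringLeft _ _ _).obj (AddRep.incl C) ⋙
    (Functor.whiskeringRight _ _ _).obj (freeOnAddMon k)

/-!
Both sides are free `k`-modules on the same set. Since `k[X] ⊗ k[Y] = k[X × Y]` and the free module
functor is a left adjoint, `k[A] ⊗_E k[B]` is free on the coend of *sets* `∫^c A(c) × B(c)`. The
content of the statement is therefore that this coend of sets, `PairCoend A B`, is the underlying
set of the coend of commutative monoids `∫^c A(c) ⊗_ℕ B(c)`.

For this, `PairCoend A B` is made into a commutative monoid by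
`[c, a, b] + [d, a', b'] = [c ⊞ d, a ⊞ a', b ⊞ b']`, where `a ⊞ a' = fst^* a + snd^* a'` and
`b ⊞ b' = inl_* b + inr_* b'`. Additivity of `B` says that `b ⊞ b` is the image of `b` under the
diagonal `c ⟶ c ⊞ c`, and sliding the diagonal across the coend gives
`[c, a, b] + [c, a', b] = [c ⊞ c, a ⊞ a', diag_* b] = [c, a + a', b]`; additivity of `A` and the
codiagonal give linearity in the other variable. So `(a, b) ↦ [c, a, b]` is biadditive and induces
a map from the coend of monoids to `PairCoend A B`. Its inverse is `[c, a, b] ↦ a ⊗ b`, which is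
additive because the mixed terms of `(a ⊞ a') ⊗ (b ⊞ b')` vanish
(`PairCoend.addEquivAddMonCoend`).

On the `k`-linear side the universal properties are used directly: `linCoendIso` matches the
generator `a ⊗ b` of `k[A] ⊗_E k[B]` with the basis vector of `k[A ⊗_E B]` at `a ⊗ b`, and
naturality is checked on these generators.
-/

/-! ### The coend of the sets of pairs -/

section

open scoped ZeroObject

variable {E : Type u} [SmallCategory.{u} E]

/-- The elementary relations of the coend of sets: for `f : c ⟶ d`, a pair over `c` whose first
entry is pulled back from `d` is identified with the pair over `d` obtained by pushing forward the
second entry. -/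
inductive PairCoend.Rel (A : Eᵒᵖ ⥤ AddCommMonCat.{u}) (B : E ⥤ AddCommMonCat.{u}) :
    (Σ c : E, A.obj (op c) × B.obj c) → (Σ c : E, A.obj (op c) × B.obj c) → Prop
  | of {c d : E} (f : c ⟶ d) (a : A.obj (op d)) (b : B.obj c) :
      PairCoend.Rel A B ⟨c, A.map f.op a, b⟩ ⟨d, a, B.map f b⟩

/-- The coend `∫^c A(c) × B(c)` of the underlying sets. -/
def PairCoend (A : Eᵒᵖ ⥤ AddCommMonCat.{u}) (B : E ⥤ AddCommMonCat.{u}) : Type u :=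
  Quot (PairCoend.Rel A B)

namespace PairCoend

variable {A : Eᵒᵖ ⥤ AddCommMonCat.{u}} {B : E ⥤ AddCommMonCat.{u}}

/-- The class of the pair `(a, b)` over `c`. -/
def mk (c : E) (a : A.obj (op c)) (b : B.obj c) : PairCoend A B := Quot.mk _ ⟨c, a, b⟩

theorem mk_eq_mk {c d : E} (f : c ⟶ d) {a : A.obj (op c)} {b : B.obj c}
    {a' : A.obj (op d)} {b' : B.obj d} (ha : A.map f.op a' = a) (hb : B.map f b = b') :
    mk c a b = (mk d a' b' : PairCoend A B) := by
  subst ha hb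
  exact Quot.sound (Rel.of f a' b)

@[elab_as_elim]
theorem ind {p : PairCoend A B → Prop} (h : ∀ c a b, p (mk c a b)) (x : PairCoend A B) : p x :=
  Quot.ind (fun ⟨c, a, b⟩ => h c a b) x

/-- The universal property of the coend of sets. -/
def lift {X : Type*} (φ : ∀ c : E, A.obj (op c) → B.obj c → X)
    (h : ∀ ⦃c d : E⦄ (f : c ⟶ d) (a : A.obj (op d)) (b : B.obj c),
      φ c (A.map f.op a) b = φ d a (B.map f b)) (x : PairCoend A B) : X :=
  Quot.lift (fun p => φ p.1 p.2.1 p.2.2) (by rintro _ _ ⟨f, a, b⟩; exact h f a b) x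

theorem contravariant_map_map (A : Eᵒᵖ ⥤ AddCommMonCat.{u}) {c d e : E} (f : c ⟶ d) (g : d ⟶ e)
    (a : A.obj (op e)) : A.map f.op (A.map g.op a) = A.map (f ≫ g).op a := by
  simp

theorem covariant_map_map (B : E ⥤ AddCommMonCat.{u}) {c d e : E} (f : c ⟶ d) (g : d ⟶ e)
    (b : B.obj c) : B.map g (B.map f b) = B.map (f ≫ g) b := by
  simp

variable [HasZeroMorphisms E] [HasBinaryBiproducts E]

/-- The class of the pair `(a ⊞ a', b ⊞ b')` over `c ⊞ d`. For additive `A`, the element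
`fst^* a + snd^* a'` is the one that corresponds to `(a, a')` under `A(c ⊞ d) ≅ A(c) × A(d)`, and
similarly for `B`; additivity is not needed for the sum to be a commutative monoid structure. -/
noncomputable def sumPair {c d : E} (a : A.obj (op c)) (b : B.obj c) (a' : A.obj (op d))
    (b' : B.obj d) : PairCoend A B :=
  mk (c ⊞ d) (A.map (biprod.fst : c ⊞ d ⟶ c).op a + A.map (biprod.snd : c ⊞ d ⟶ d).op a')
    (B.map (biprod.inl : c ⟶ c ⊞ d) b + B.map (biprod.inr : d ⟶ c ⊞ d) b')

theorem sumPair_comm {c d : E} (a : A.obj (op c)) (b : B.obj c) (a' : A.obj (op d))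
    (b' : B.obj d) : sumPair a b a' b' = (sumPair a' b' a b : PairCoend A B) := by
  refine mk_eq_mk (biprod.lift biprod.snd biprod.fst) ?_ ?_
  · rw [map_add, contravariant_map_map, contravariant_map_map, biprod.lift_fst, biprod.lift_snd,
      add_comm]
  · have h₁ : biprod.inl ≫ biprod.lift biprod.snd biprod.fst = (biprod.inr : c ⟶ d ⊞ c) := by
      ext <;> simp
    have h₂ : biprod.inr ≫ biprod.lift biprod.snd biprod.fst = (biprod.inl : d ⟶ d ⊞ c) := by
      ext <;> simp
    rw [map_add, covariant_map_map, covariant_map_map, h₁, h₂, add_comm]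

/-- The sum respects the relations in its first summand; by `sumPair_comm` also in the second. -/
theorem sumPair_map_left {c c' d : E} (f : c ⟶ c') (a : A.obj (op c')) (b : B.obj c)
    (a' : A.obj (op d)) (b' : B.obj d) :
    sumPair (A.map f.op a) b a' b' = (sumPair a (B.map f b) a' b' : PairCoend A B) := by
  refine mk_eq_mk (biprod.map f (𝟙 d)) ?_ ?_
  · rw [map_add, contravariant_map_map, contravariant_map_map, contravariant_map_map]
    simp
  · rw [map_add, covariant_map_map, covariant_map_map, covariant_map_map]
    simp

/-- The sum is induced by `sumPair`. -/
noncomputable instance : Add (PairCoend A B) where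
  add x y := lift
    (fun _ a b => lift (fun _ a' b' => sumPair a b a' b')
      (fun _ _ f a' b' => by
        rw [sumPair_comm, sumPair_map_left, sumPair_comm]) y)
    (fun _ _ f a b => by
      induction y using ind with
      | h d a' b' => exact sumPair_map_left f a b a' b') x

theorem mk_add_mk {c d : E} (a : A.obj (op c)) (b : B.obj c) (a' : A.obj (op d)) (b' : B.obj d) :
    mk c a b + mk d a' b' = (sumPair a b a' b' : PairCoend A B) := rfl

variable [HasZeroObject E]

/-- The zero is the class of the pair `(0, 0)` over the zero object. -/
noncomputable instance : Zero (PairCoend A B) where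
  zero := mk (0 : E) 0 0

noncomputable instance : AddCommMonoid (PairCoend A B) where
  add_comm x y := by
    induction x using ind with | h c a b
    induction y using ind with | h d a' b'
    exact sumPair_comm a b a' b'
  zero_add x := by
    induction x using ind with | h c a b
    refine mk_eq_mk biprod.snd ?_ ?_
    · rw [map_zero, zero_add]
    · rw [map_zero, zero_add, covariant_map_map, biprod.inr_snd, B.map_id]
      rfl
  add_zero x := by
    induction x using ind with | h c a b
    refine mk_eq_mk biprod.fst ?_ ?_
    · rw [map_zero, add_zero]
    · rw [map_zero, add_zero, covariant_map_map, biprod.inl_fst, B.map_id]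
      rfl
  add_assoc x y z := by
    induction x using ind with | h c a b
    induction y using ind with | h d a' b'
    induction z using ind with | h e a'' b''
    simp only [mk_add_mk, sumPair]
    let f : (c ⊞ d) ⊞ e ⟶ c ⊞ d ⊞ e := biprod.lift (biprod.fst ≫ biprod.fst)
      (biprod.lift (biprod.fst ≫ biprod.snd) biprod.snd)
    have h₁ : biprod.inl ≫ biprod.inl ≫ f = biprod.inl := by ext <;> simp [f]
    have h₂ : biprod.inr ≫ biprod.inl ≫ f = biprod.inl ≫ biprod.inr := by ext <;> simp [f]
    have h₃ : biprod.inr ≫ f = biprod.inr ≫ biprod.inr := by ext <;> simp [f]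
    refine mk_eq_mk f ?_ ?_
    · simp only [f, map_add, contravariant_map_map, biprod.lift_fst, biprod.lift_snd,
        biprod.lift_snd_assoc, add_assoc]
    · simp only [map_add, covariant_map_map, add_assoc, Category.assoc, h₁, h₂, h₃]
  nsmul := nsmulRec

end PairCoend

/-! ### Additive functors -/

/-- An element of the value of an additive functor at a product is determined by its two
components. -/
theorem map_eq_of_fan {C : Type u} [Category.{u} C] (F : C ⥤ AddCommMonCat.{u})
    [PreservesFiniteProducts F] {P X Y : C} (p : P ⟶ X) (q : P ⟶ Y)
    (hs : IsLimit (BinaryFan.mk p q)) {x y : F.obj P} (h₁ : F.map p x = F.map p y)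
    (h₂ : F.map q x = F.map q y) :
    x = y := by
  apply Concrete.isLimit_ext _ (isLimitOfPreserves F hs)
  rintro ⟨⟨⟩⟩
  · exact h₁
  · exact h₂

theorem subsingleton_obj_of_isTerminal {C : Type u} [Category.{u} C] (F : C ⥤ AddCommMonCat.{u})
    [PreservesFiniteProducts F] {T : C} (hT : IsTerminal T) : Subsingleton (F.obj T) where
  allEq x y := by
    apply Concrete.isLimit_ext _ (isLimitOfPreserves F hT)
    rintro ⟨⟨⟩⟩

section ZeroMorphisms

variable [HasZeroMorphisms E] [HasZeroObject E]

theorem contravariant_map_zero_hom (A : Eᵒᵖ ⥤ AddCommMonCat.{u}) [PreservesFiniteProducts A]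
    {c d : E} (a : A.obj (op d)) : A.map (0 : c ⟶ d).op a = 0 := by
  have := subsingleton_obj_of_isTerminal A (terminalOpOfInitial (isZero_zero E).isInitial)
  rw [← comp_zero (X := c) (f := (0 : c ⟶ 0)) (Z := d), ← PairCoend.contravariant_map_map,
    Subsingleton.elim (A.map (0 : 0 ⟶ d).op a) 0, map_zero]

theorem covariant_map_zero_hom (B : E ⥤ AddCommMonCat.{u}) [PreservesFiniteProducts B]
    {c d : E} (b : B.obj c) : B.map (0 : c ⟶ d) b = 0 := by
  have := subsingleton_obj_of_isTerminal B (isZero_zero E).isTerminal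
  rw [← comp_zero (X := c) (f := (0 : c ⟶ 0)) (Z := d), ← PairCoend.covariant_map_map,
    Subsingleton.elim (B.map (0 : c ⟶ 0) b) 0, map_zero]

variable [HasBinaryBiproducts E]

/-- An additive functor sends the diagonal to the diagonal: `diag_* b = b ⊞ b`. -/
theorem covariant_map_diag (B : E ⥤ AddCommMonCat.{u}) [PreservesFiniteProducts B]
    {c : E} (b : B.obj c) : B.map (biprod.lift (𝟙 c) (𝟙 c)) b =
      B.map (biprod.inl : c ⟶ c ⊞ c) b + B.map (biprod.inr : c ⟶ c ⊞ c) b := by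
  apply map_eq_of_fan B biprod.fst biprod.snd (BinaryBiproduct.isLimit c c)
  · simp only [map_add, PairCoend.covariant_map_map, biprod.lift_fst, biprod.inl_fst,
      biprod.inr_fst, covariant_map_zero_hom, add_zero]
  · simp only [map_add, PairCoend.covariant_map_map, biprod.lift_snd, biprod.inl_snd,
      biprod.inr_snd, covariant_map_zero_hom, zero_add]

/-- An additive contravariant functor sends the codiagonal to the diagonal:
`codiag^* a = a ⊞ a`. -/
theorem contravariant_map_codiag (A : Eᵒᵖ ⥤ AddCommMonCat.{u}) [PreservesFiniteProducts A]
    {c : E} (a : A.obj (op c)) : A.map (biprod.desc (𝟙 c) (𝟙 c)).op a =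
      A.map (biprod.fst : c ⊞ c ⟶ c).op a + A.map (biprod.snd : c ⊞ c ⟶ c).op a := by
  have hs : IsLimit (BinaryFan.mk (biprod.inl : c ⟶ c ⊞ c).op (biprod.inr : c ⟶ c ⊞ c).op) :=
    BinaryCofan.IsColimit.op (BinaryBiproduct.isColimit c c)
  apply map_eq_of_fan A _ _ hs
  · simp only [map_add, PairCoend.contravariant_map_map, biprod.inl_desc, biprod.inl_fst,
      biprod.inl_snd, contravariant_map_zero_hom, add_zero]
  · simp only [map_add, PairCoend.contravariant_map_map, biprod.inr_desc, biprod.inr_fst,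
      biprod.inr_snd, contravariant_map_zero_hom, zero_add]

end ZeroMorphisms

/-! ### The coend of commutative monoids -/

/-- The coend `∫^c A(c) ⊗_ℕ B(c)` of commutative monoids. -/
noncomputable abbrev addMonCoend (A : Eᵒᵖ ⥤ AddCommMonCat.{u}) (B : E ⥤ AddCommMonCat.{u}) :
    AddCommMonCat.{u} :=
  coend (externalTensorObj addMonTensor A B)

namespace addMonCoend

variable {A A' : Eᵒᵖ ⥤ AddCommMonCat.{u}} {B B' : E ⥤ AddCommMonCat.{u}}

/-- The class of the pure tensor `a ⊗ b` over `c`. -/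
noncomputable def mk (c : E) (a : A.obj (op c)) (b : B.obj c) : addMonCoend A B :=
  (coend.ι (externalTensorObj addMonTensor A B) c).hom (a ⊗ₜ[ℕ] b : A.obj (op c) ⊗[ℕ] B.obj c)

theorem mk_add_left (c : E) (a a' : A.obj (op c)) (b : B.obj c) :
    mk c (a + a') b = (mk c a b + mk c a' b : addMonCoend A B) :=
  (congrArg (coend.ι (externalTensorObj addMonTensor A B) c).hom
    (TensorProduct.add_tmul a a' b)).trans (map_add _ _ _)

theorem mk_add_right (c : E) (a : A.obj (op c)) (b b' : B.obj c) :
    mk c a (b + b') = (mk c a b + mk c a b' : addMonCoend A B) :=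
  (congrArg (coend.ι (externalTensorObj addMonTensor A B) c).hom
    (TensorProduct.tmul_add a b b')).trans (map_add _ _ _)

theorem mk_zero_right (c : E) (a : A.obj (op c)) : mk c a 0 = (0 : addMonCoend A B) :=
  (congrArg (coend.ι (externalTensorObj addMonTensor A B) c).hom
    (TensorProduct.tmul_zero (R := ℕ) (N := B.obj c) a)).trans (map_zero _)

theorem mk_map {c d : E} (f : c ⟶ d) (a : A.obj (op d)) (b : B.obj c) :
    mk c (A.map f.op a) b = (mk d a (B.map f b) : addMonCoend A B) :=
  ConcreteCategory.congr_hom (coend.condition (externalTensorObj addMonTensor A B) f)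
    (a ⊗ₜ[ℕ] b : A.obj (op d) ⊗[ℕ] B.obj c)

theorem hom_ext {M : AddCommMonCat.{u}} {φ ψ : addMonCoend A B ⟶ M}
    (h : ∀ c (a : A.obj (op c)) (b : B.obj c), φ (mk c a b) = ψ (mk c a b)) : φ = ψ :=
  coend.hom_ext fun c => addMonTensor_hom_ext (h c)

theorem map_left_mk (α : A ⟶ A') (c : E) (a : A.obj (op c)) (b : B.obj c) :
    coend.map (externalTensorMapLeft addMonTensor α B) (mk c a b) = mk c (α.app (op c) a) b :=
  ConcreteCategory.congr_hom (coend.ι_map (externalTensorMapLeft addMonTensor α B) c)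
    (a ⊗ₜ[ℕ] b : A.obj (op c) ⊗[ℕ] B.obj c)

theorem map_right_mk (β : B ⟶ B') (c : E) (a : A.obj (op c)) (b : B.obj c) :
    coend.map (externalTensorMapRight addMonTensor A β) (mk c a b) = mk c a (β.app c b) :=
  ConcreteCategory.congr_hom (coend.ι_map (externalTensorMapRight addMonTensor A β) c)
    (a ⊗ₜ[ℕ] b : A.obj (op c) ⊗[ℕ] B.obj c)

/-- The map out of the coend attached to a family of biadditive maps compatible with the morphisms
of `E`. -/
noncomputable def desc {M : AddCommMonCat.{u}} (φ : ∀ c : E, A.obj (op c) →+ B.obj c →+ M)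
    (h : ∀ ⦃c d : E⦄ (f : c ⟶ d) (a : A.obj (op d)) (b : B.obj c),
      φ c (A.map f.op a) b = φ d a (B.map f b)) : addMonCoend A B ⟶ M :=
  coend.desc (F := externalTensorObj addMonTensor A B)
    (fun c => AddCommMonCat.ofHom (TensorProduct.liftAddHom (φ c) (by simp)))
    (fun c d f => addMonTensor_hom_ext fun a b => h f a b)

theorem desc_mk {M : AddCommMonCat.{u}} (φ : ∀ c : E, A.obj (op c) →+ B.obj c →+ M)
    (h : ∀ ⦃c d : E⦄ (f : c ⟶ d) (a : A.obj (op d)) (b : B.obj c),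
      φ c (A.map f.op a) b = φ d a (B.map f b)) (c : E) (a : A.obj (op c)) (b : B.obj c) :
    desc φ h (mk c a b) = φ c a b :=
  ConcreteCategory.congr_hom (coend.ι_desc (F := externalTensorObj addMonTensor A B) _ _ c)
    (a ⊗ₜ[ℕ] b : A.obj (op c) ⊗[ℕ] B.obj c)

end addMonCoend

/-! ### The two coends agree -/

section Compare

variable [HasZeroMorphisms E] [HasZeroObject E] [HasBinaryBiproducts E]
  (A : Eᵒᵖ ⥤ AddCommMonCat.{u}) (B : E ⥤ AddCommMonCat.{u})

namespace PairCoend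

/-- The diagonal of `c`, slid across the coend, turns `[c, a, b] + [c, a', b]` into
`[c, a + a', b]`. -/
theorem mk_add_left [PreservesFiniteProducts B] {c : E} (a a' : A.obj (op c)) (b : B.obj c) :
    mk c (a + a') b = (mk c a b + mk c a' b : PairCoend A B) := by
  refine mk_eq_mk (biprod.lift (𝟙 c) (𝟙 c)) ?_ (covariant_map_diag B b)
  rw [map_add, contravariant_map_map, contravariant_map_map, biprod.lift_fst, biprod.lift_snd,
    op_id, A.map_id]
  rfl

/-- The codiagonal of `c`, slid across the coend, turns `[c, a, b] + [c, a, b']` into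
`[c, a, b + b']`. -/
theorem mk_add_right [PreservesFiniteProducts A] {c : E} (a : A.obj (op c)) (b b' : B.obj c) :
    mk c a (b + b') = (mk c a b + mk c a b' : PairCoend A B) := by
  refine (mk_eq_mk (biprod.desc (𝟙 c) (𝟙 c)) (contravariant_map_codiag A a) ?_).symm
  rw [map_add, covariant_map_map, covariant_map_map, biprod.inl_desc, biprod.inr_desc, B.map_id]
  rfl

variable [PreservesFiniteProducts A] [PreservesFiniteProducts B]

/-- The biadditive map `(a, b) ↦ [c, a, b]`. -/
noncomputable def pairing (c : E) : A.obj (op c) →+ B.obj c →+ PairCoend A B where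
  toFun a :=
    { toFun := fun b => mk c a b
      map_zero' := (mk_eq_mk (0 : 0 ⟶ c) (contravariant_map_zero_hom A a) (map_zero _)).symm
      map_add' := mk_add_right A B a }
  map_zero' := AddMonoidHom.ext fun b =>
    mk_eq_mk (0 : c ⟶ 0) (map_zero _) (covariant_map_zero_hom B b)
  map_add' a a' := AddMonoidHom.ext fun b => mk_add_left A B a a' b

/-- The additive map `[c, a, b] ↦ a ⊗ b`. -/
noncomputable def toAddMonCoend : PairCoend A B →+ addMonCoend A B where
  toFun := lift addMonCoend.mk (fun _ _ => addMonCoend.mk_map)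
  map_zero' := addMonCoend.mk_zero_right _ _
  map_add' x y := by
    induction x using ind with | h c a b
    induction y using ind with | h d a' b'
    change addMonCoend.mk (c ⊞ d) _ _ = addMonCoend.mk c a b + addMonCoend.mk d a' b'
    -- Moving each pullback `fst^*`, `snd^*` to the other side turns the four terms of the expansion
    -- into `a ⊗ b`, `a ⊗ 0_* b'`, `a' ⊗ 0_* b` and `a' ⊗ b'`, and `0_*` is zero.
    simp only [addMonCoend.mk_add_left, addMonCoend.mk_map, map_add,
      covariant_map_map, biprod.inl_fst, biprod.inl_snd, biprod.inr_fst,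
      biprod.inr_snd, covariant_map_zero_hom, B.map_id, add_zero, zero_add]
    rfl

/-- The coend of sets is the underlying set of the coend of commutative monoids. -/
noncomputable def addEquivAddMonCoend : PairCoend A B ≃+ addMonCoend A B :=
  let ψ : addMonCoend A B ⟶ AddCommMonCat.of (PairCoend A B) :=
    addMonCoend.desc (pairing A B) fun _ _ f _ _ => mk_eq_mk f rfl rfl
  have hψ (c : E) (a : A.obj (op c)) (b : B.obj c) : ψ.hom (addMonCoend.mk c a b) = mk c a b :=
    addMonCoend.desc_mk (M := AddCommMonCat.of (PairCoend A B)) _ _ c a b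
  { toAddMonCoend A B with
    invFun := ψ.hom
    left_inv := fun x => by
      induction x using ind with | h c a b
      exact hψ c a b
    right_inv := ConcreteCategory.congr_hom (f := ψ ≫ AddCommMonCat.ofHom (toAddMonCoend A B))
      (g := 𝟙 _) (addMonCoend.hom_ext fun c a b => congrArg (toAddMonCoend A B) (hψ c a b)) }

end PairCoend

end Compare

/-! ### The coend of free modules -/

section Linear

variable (k : Type u) [CommRing k]

theorem free_tensor_hom_ext {X Y : Type u} {M : ModuleCat.{u} k}
    {f g : MonoidalCategory.tensorObj ((ModuleCat.free k).obj X) ((ModuleCat.free k).obj Y) ⟶ M}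
    (h : ∀ x y, f (ModuleCat.freeMk x ⊗ₜ[k] ModuleCat.freeMk y) =
      g (ModuleCat.freeMk x ⊗ₜ[k] ModuleCat.freeMk y)) : f = g := by
  rw [← cancel_epi (ModuleCat.FreeMonoidal.μIso k X Y).inv]
  refine ModuleCat.free_hom_ext fun z => ?_
  rw [ConcreteCategory.comp_apply, ConcreteCategory.comp_apply,
    ModuleCat.FreeMonoidal.μIso_inv_freeMk]
  exact h _ _

/-- The linear map `k[X] ⊗ k[Y] ⟶ M` attached to a map of sets `X × Y → M`. -/
noncomputable def freeTensorDesc {X Y : Type u} {M : ModuleCat.{u} k} (φ : X → Y → M) :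
    MonoidalCategory.tensorObj ((ModuleCat.free k).obj X) ((ModuleCat.free k).obj Y) ⟶ M :=
  (ModuleCat.FreeMonoidal.μIso k X Y).hom ≫ ModuleCat.freeDesc (↾fun p : X × Y => φ p.1 p.2)

theorem freeTensorDesc_tmul {X Y : Type u} {M : ModuleCat.{u} k} (φ : X → Y → M) (x : X) (y : Y) :
    freeTensorDesc k φ (ModuleCat.freeMk x ⊗ₜ[k] ModuleCat.freeMk y) = φ x y := by
  rw [freeTensorDesc, ConcreteCategory.comp_apply,
    ModuleCat.FreeMonoidal.μIso_hom_freeMk_tmul_freeMk]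
  exact ModuleCat.freeDesc_apply _ _

theorem curriedTensor_map_left {X X' Y : Type u} (f : X ⟶ X') (x : X) (y : Y) :
    ((MonoidalCategory.curriedTensor (ModuleCat.{u} k)).map ((ModuleCat.free k).map f)).app
      ((ModuleCat.free k).obj Y) (ModuleCat.freeMk x ⊗ₜ[k] ModuleCat.freeMk y :
      (ModuleCat.free k).obj X ⊗[k] (ModuleCat.free k).obj Y) =
    (ModuleCat.freeMk (f x) ⊗ₜ[k] ModuleCat.freeMk y :
      (ModuleCat.free k).obj X' ⊗[k] (ModuleCat.free k).obj Y) := by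
  refine (ModuleCat.MonoidalCategory.whiskerRight_apply _ _ _ _).trans ?_
  rw [ModuleCat.free_map_apply]

theorem curriedTensor_map_right {X Y Y' : Type u} (f : Y ⟶ Y') (x : X) (y : Y) :
    ((MonoidalCategory.curriedTensor (ModuleCat.{u} k)).obj ((ModuleCat.free k).obj X)).map
      ((ModuleCat.free k).map f) (ModuleCat.freeMk x ⊗ₜ[k] ModuleCat.freeMk y :
      (ModuleCat.free k).obj X ⊗[k] (ModuleCat.free k).obj Y) =
    (ModuleCat.freeMk x ⊗ₜ[k] ModuleCat.freeMk (f y) :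
      (ModuleCat.free k).obj X ⊗[k] (ModuleCat.free k).obj Y') := by
  refine (ModuleCat.MonoidalCategory.whiskerLeft_apply _ _ _ _).trans ?_
  rw [ModuleCat.free_map_apply]

/-- The bifunctor `(c, c') ↦ k[A(c)] ⊗ k[B(c')]`. -/
noncomputable abbrev linTensor (A : Eᵒᵖ ⥤ AddCommMonCat.{u}) (B : E ⥤ AddCommMonCat.{u}) :
    Eᵒᵖ ⥤ E ⥤ ModuleCat.{u} k :=
  externalTensorObj (MonoidalCategory.curriedTensor (ModuleCat.{u} k))
    (A ⋙ freeOnAddMon k) (B ⋙ freeOnAddMon k)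

/-- The coend `∫^c k[A(c)] ⊗ k[B(c)]` of `k`-modules. -/
noncomputable abbrev linCoend (A : Eᵒᵖ ⥤ AddCommMonCat.{u}) (B : E ⥤ AddCommMonCat.{u}) :
    ModuleCat.{u} k :=
  coend (linTensor k A B)

namespace linCoend

variable {A A' : Eᵒᵖ ⥤ AddCommMonCat.{u}} {B B' : E ⥤ AddCommMonCat.{u}}

/-- The class over `c` of the tensor product of the basis vectors at `a` and `b`. -/
noncomputable def mk (c : E) (a : A.obj (op c)) (b : B.obj c) : linCoend k A B :=
  coend.ι (linTensor k A B) c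
    (ModuleCat.freeMk a ⊗ₜ[k] ModuleCat.freeMk b :
      (ModuleCat.free k).obj (A.obj (op c)) ⊗[k] (ModuleCat.free k).obj (B.obj c))

theorem mk_map {c d : E} (f : c ⟶ d) (a : A.obj (op d)) (b : B.obj c) :
    mk k c (A.map f.op a) b = (mk k d a (B.map f b) : linCoend k A B) := by
  have h := ConcreteCategory.congr_hom (coend.condition (linTensor k A B) f)
    (ModuleCat.freeMk a ⊗ₜ[k] ModuleCat.freeMk b :
      (ModuleCat.free k).obj (A.obj (op d)) ⊗[k] (ModuleCat.free k).obj (B.obj c))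
  have h₁ := curriedTensor_map_left k ((forget _).map (A.map f.op)) a (Y := B.obj c) b
  have h₂ := curriedTensor_map_right k ((forget _).map (B.map f)) (X := A.obj (op d)) a b
  exact (congrArg (coend.ι (linTensor k A B) c) h₁).symm.trans (h.trans
      (congrArg (coend.ι (linTensor k A B) d) h₂))

theorem hom_ext {M : ModuleCat.{u} k} {φ ψ : linCoend k A B ⟶ M}
    (h : ∀ c (a : A.obj (op c)) (b : B.obj c), φ (mk k c a b) = ψ (mk k c a b)) : φ = ψ :=
  coend.hom_ext fun c => free_tensor_hom_ext k (h c)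

/-- The linear map out of the coend attached to a family of maps of sets compatible with the
morphisms of `E`. -/
noncomputable def desc {M : ModuleCat.{u} k} (φ : ∀ c : E, A.obj (op c) → B.obj c → M)
    (h : ∀ ⦃c d : E⦄ (f : c ⟶ d) (a : A.obj (op d)) (b : B.obj c),
      φ c (A.map f.op a) b = φ d a (B.map f b)) : linCoend k A B ⟶ M :=
  coend.desc (fun c => freeTensorDesc k (φ c))
    (fun c d f => free_tensor_hom_ext k fun a b =>
      (congrArg (freeTensorDesc k (φ c))
        (curriedTensor_map_left k ((forget _).map (A.map f.op)) a b)).trans <|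
      (freeTensorDesc_tmul k (φ c) _ b).trans <| (h f a b).trans <|
      (freeTensorDesc_tmul k (φ d) a _).symm.trans
      (congrArg (freeTensorDesc k (φ d))
        (curriedTensor_map_right k ((forget _).map (B.map f)) a b)).symm)

theorem desc_mk {M : ModuleCat.{u} k} (φ : ∀ c : E, A.obj (op c) → B.obj c → M)
    (h : ∀ ⦃c d : E⦄ (f : c ⟶ d) (a : A.obj (op d)) (b : B.obj c),
      φ c (A.map f.op a) b = φ d a (B.map f b)) (c : E) (a : A.obj (op c)) (b : B.obj c) :
    desc k φ h (mk k c a b) = φ c a b :=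
  (ConcreteCategory.congr_hom (coend.ι_desc (F := linTensor k A B) _ _ c) _).trans
    (freeTensorDesc_tmul k (φ c) a b)

theorem map_left_mk (α : A ⟶ A') (c : E) (a : A.obj (op c)) (b : B.obj c) :
    coend.map (externalTensorMapLeft (MonoidalCategory.curriedTensor (ModuleCat.{u} k))
      (Functor.whiskerRight α (freeOnAddMon k)) (B ⋙ freeOnAddMon k)) (mk k c a b) =
    mk k c (α.app (op c) a) b := by
  have h := ConcreteCategory.congr_hom (coend.ι_map (externalTensorMapLeft
    (MonoidalCategory.curriedTensor (ModuleCat.{u} k)) (Functor.whiskerRight α (freeOnAddMon k))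
    (B ⋙ freeOnAddMon k)) c)
    (ModuleCat.freeMk a ⊗ₜ[k] ModuleCat.freeMk b :
      (ModuleCat.free k).obj (A.obj (op c)) ⊗[k] (ModuleCat.free k).obj (B.obj c))
  have h' := curriedTensor_map_left k ((forget _).map (α.app (op c))) a (Y := B.obj c) b
  exact h.trans (congrArg (coend.ι (linTensor k A' B) c) h')

theorem map_right_mk (β : B ⟶ B') (c : E) (a : A.obj (op c)) (b : B.obj c) :
    coend.map (externalTensorMapRight (MonoidalCategory.curriedTensor (ModuleCat.{u} k))
      (A ⋙ freeOnAddMon k) (Functor.whiskerRight β (freeOnAddMon k))) (mk k c a b) =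
    mk k c a (β.app c b) := by
  have h := ConcreteCategory.congr_hom (coend.ι_map (externalTensorMapRight
    (MonoidalCategory.curriedTensor (ModuleCat.{u} k)) (A ⋙ freeOnAddMon k)
    (Functor.whiskerRight β (freeOnAddMon k))) c)
    (ModuleCat.freeMk a ⊗ₜ[k] ModuleCat.freeMk b :
      (ModuleCat.free k).obj (A.obj (op c)) ⊗[k] (ModuleCat.free k).obj (B.obj c))
  have h' := curriedTensor_map_right k ((forget _).map (β.app c)) (X := A.obj (op c)) a b
  exact h.trans (congrArg (coend.ι (linTensor k A B') c) h')

end linCoend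

/-! ### The isomorphism -/

section Iso

variable (A : Eᵒᵖ ⥤ AddCommMonCat.{u}) (B : E ⥤ AddCommMonCat.{u})

/-- The linear map that sends the generator `a ⊗ b` to the basis vector at `a ⊗ b`. -/
noncomputable def linCoendToFree : linCoend k A B ⟶ (freeOnAddMon k).obj (addMonCoend A B) :=
  linCoend.desc k (fun c a b => ModuleCat.freeMk (addMonCoend.mk c a b))
    (fun _ _ f a b => congrArg ModuleCat.freeMk (addMonCoend.mk_map f a b))

variable {A B} in
theorem linCoendToFree_mk (c : E) (a : A.obj (op c)) (b : B.obj c) :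
    linCoendToFree k A B (linCoend.mk k c a b) = ModuleCat.freeMk (addMonCoend.mk c a b) :=
  linCoend.desc_mk k _ _ c a b

variable [HasZeroMorphisms E] [HasZeroObject E] [HasBinaryBiproducts E]
  [PreservesFiniteProducts A] [PreservesFiniteProducts B]

/-- The inverse: a basis vector is a class `[c, a, b]` in the coend of sets, which is sent to the
generator `a ⊗ b`. -/
noncomputable def freeToLinCoend : (freeOnAddMon k).obj (addMonCoend A B) ⟶ linCoend k A B :=
  ModuleCat.freeDesc (↾fun x => PairCoend.lift (fun c a b => linCoend.mk k c a b)
    (fun _ _ f a b => linCoend.mk_map k f a b) ((PairCoend.addEquivAddMonCoend A B).symm x))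

variable {A B} in
theorem freeToLinCoend_mk (c : E) (a : A.obj (op c)) (b : B.obj c) :
    freeToLinCoend k A B (ModuleCat.freeMk (addMonCoend.mk c a b)) = linCoend.mk k c a b :=
  (ModuleCat.freeDesc_apply _ _).trans <| congrArg
    (PairCoend.lift (fun c a b => linCoend.mk k c a b) fun _ _ f a b => linCoend.mk_map k f a b)
    ((PairCoend.addEquivAddMonCoend A B).symm_apply_apply (PairCoend.mk c a b))

/-- The isomorphism `k[A] ⊗_E k[B] ≅ k[A ⊗_E B]`. -/
noncomputable def linCoendIso : linCoend k A B ≅ (freeOnAddMon k).obj (addMonCoend A B) where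
  hom := linCoendToFree k A B
  inv := freeToLinCoend k A B
  hom_inv_id := linCoend.hom_ext k fun c a b =>
    (congrArg (freeToLinCoend k A B) (linCoendToFree_mk k c a b)).trans (freeToLinCoend_mk k c a b)
  inv_hom_id := ModuleCat.free_hom_ext fun x => by
    obtain ⟨y, rfl⟩ := (PairCoend.addEquivAddMonCoend A B).surjective x
    induction y using PairCoend.ind with | h c a b
    exact (congrArg (linCoendToFree k A B) (freeToLinCoend_mk k c a b)).trans
      (linCoendToFree_mk k c a b)

end Iso

end Linear

end

/-- `E` is a small semi-additive category and `k` a commutative ring; a natural isomorphism of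
bifunctors is an isomorphism `k[A] ⊗_E k[B] ≅ k[A ⊗_E B]` that is natural in `A` and `B`. -/
theorem proposition3p4 (k : Type u) [CommRing k]
    (E : Type u) [SmallCategory.{u} E] [HasZeroMorphisms E] [HasFiniteBiproducts E] :
    Nonempty (tensorOfLinearizations k E ≅ linearizationOfTensor k E) := by
  have : HasBinaryBiproducts E := hasBinaryBiproducts_of_finite_biproducts E
  have hA (A : AddRep Eᵒᵖ) : PreservesFiniteProducts A.obj := A.property
  have hB (B : AddRep E) : PreservesFiniteProducts B.obj := B.property
  refine ⟨NatIso.ofComponents (fun A => NatIso.ofComponents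
    (fun B => linCoendIso k A.obj B.obj) fun {B B'} β => ?_) fun {A A'} α => ?_⟩
  · refine linCoend.hom_ext k fun c a b => ?_
    refine (congrArg (linCoendToFree k A.obj B'.obj)
      (linCoend.map_right_mk k β.hom c a b)).trans ?_
    refine (linCoendToFree_mk k c a (β.hom.app c b)).trans ?_
    refine .trans ?_ (congrArg ((freeOnAddMon k).map
      (coend.map (externalTensorMapRight addMonTensor A.obj β.hom)))
      (linCoendToFree_mk k c a b)).symm
    refine .trans ?_ (ModuleCat.free_map_apply _ _).symm
    exact congrArg ModuleCat.freeMk (addMonCoend.map_right_mk β.hom c a b).symm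
  · ext B : 2
    refine linCoend.hom_ext k fun c a b => ?_
    refine (congrArg (linCoendToFree k A'.obj B.obj)
      (linCoend.map_left_mk k α.hom c a b)).trans ?_
    refine (linCoendToFree_mk k c (α.hom.app (op c) a) b).trans ?_
    refine .trans ?_ (congrArg ((freeOnAddMon k).map
      (coend.map (externalTensorMapLeft addMonTensor α.hom B.obj)))
      (linCoendToFree_mk k c a b)).symm
    refine .trans ?_ (ModuleCat.free_map_apply _ _).symm
    exact congrArg ModuleCat.freeMk (addMonCoend.map_left_mk α.hom c a b).symm
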